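/- Let $n\ge 1$ and let $\mathbf{PL}_n=\langle\{0,\tfrac1n,\dots,\tfrac{n-1}n,1\},\wedge,\vee,\odot,\oplus,0,1\rangle$ be the $(n+1)$-element positive MV-chain, where $\wedge,\vee$ are minimum and maximum, $x\odot y=\max\{0,x+y-1\}$ and $x\oplus y=\min\{1,x+y\}$. A $\mathsf{PMV}_n$-algebra is a member of the variety generated by $\mathbf{PL}_n$, that is, an algebra $\mathbf A$ of the same signature that satisfies every identity valid in $\mathbf{PL}_n$. Its distributive skeleton $\mathfrak S(\mathbf A)$ is the bounded distributive lattice on $\{a\in A\mid a\oplus a=a\}$ with $\wedge,\vee,0,1$ inherited from $\mathbf A$. For a bounded distributive lattice $\mathbf L$, let $\mathsf D(\mathbf L)$ be its Priestley dual: the set of bounded lattice homomorphisms $\mathbf L\to\mathbf 2$, ordered pointwise and topologized as a subspace of the power $2^L$ of the discrete space $2=\{0,1\}$. The Priestley power $\mathfrak P(\mathbf L)=\mathbf{PL}_n[\mathbf L]$ is the algebra of all continuous order-preserving maps from $\mathsf D(\mathbf L)$ to $\{0,\tfrac1n,\dots,1\}$ (with its natural order and the discrete topology), with pointwise operations $\wedge,\vee,\odot,\oplus,0,1$.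 Then for every $\mathsf{PMV}_n$-algebra $\mathbf A$ there is an embedding (an injective homomorphism) $\mathbf A\hookrightarrow\mathfrak P(\mathfrak S(\mathbf A))$. In particular, every $\mathsf{PMV}_n$-algebra is isomorphic to a subalgebra of a Priestley power $\mathbf{PL}_n[\mathbf L]$ for some bounded distributive lattice $\mathbf L$. -/

import Mathlib

open FirstOrder

universe u v w

namespace PosMV

/-! ### The signature `∧, ∨, ⊙, ⊕, 0, 1` -/

/-- Operation symbols of positive MV-algebras, indexed by arity. -/
inductive Op : ℕ → Type
  | zero : Op 0
  | one : Op 0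
  | inf : Op 2
  | sup : Op 2
  | odot : Op 2
  | oplus : Op 2

/-- The algebraic signature `⟨∧, ∨, ⊙, ⊕, 0, 1⟩` of positive MV-algebras (no relation symbols). -/
def sig : FirstOrder.Language.{0, 0} := ⟨Op, fun _ => Empty⟩

instance : sig.IsAlgebraic := fun _ => (inferInstance : IsEmpty Empty)

section operations

variable {A : Type u} [sig.Structure A]

/-- Interpretation of the constant `0` in an algebra of the signature. -/
def zero (A : Type u) [sig.Structure A] : A :=
  Language.Structure.funMap (L := sig) (M := A) (n := 0) Op.zero ![]

/-- Interpretation of the constant `1`. -/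
def one (A : Type u) [sig.Structure A] : A :=
  Language.Structure.funMap (L := sig) (M := A) (n := 0) Op.one ![]

/-- Interpretation of `∧`. -/
def inf (a b : A) : A := Language.Structure.funMap (L := sig) (M := A) (n := 2) Op.inf ![a, b]

/-- Interpretation of `∨`. -/
def sup (a b : A) : A := Language.Structure.funMap (L := sig) (M := A) (n := 2) Op.sup ![a, b]

/-- Interpretation of `⊙`. -/
def odot (a b : A) : A := Language.Structure.funMap (L := sig) (M := A) (n := 2) Op.odot ![a, b]

/-- Interpretation of `⊕`. -/
def oplus (a b : A) : A := Language.Structure.funMap (L := sig) (M := A) (n := 2) Op.oplus ![a, b]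

end operations

/-! ### The positive MV-chains -/

/-- `x ⊙ y = max {0, x + y - 1}` on the real unit interval. -/
def unitOdot (x y : unitInterval) : unitInterval :=
  ⟨max 0 ((x : ℝ) + y - 1), le_max_left _ _,
    max_le zero_le_one (by have := x.2.2; have := y.2.2; linarith)⟩

/-- `x ⊕ y = min {1, x + y}` on the real unit interval. -/
def unitOplus (x y : unitInterval) : unitInterval :=
  ⟨min 1 ((x : ℝ) + y), le_min zero_le_one (add_nonneg x.2.1 y.2.1), min_le_left _ _⟩

/-- The negation-free reduct of the standard MV-algebra on the real unit interval `[0, 1]`. -/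
instance unitStructure : sig.Structure unitInterval where
  funMap {_} f x :=
    match f, x with
    | Op.zero, _ => 0
    | Op.one, _ => 1
    | Op.inf, x => min (x 0) (x 1)
    | Op.sup, x => max (x 0) (x 1)
    | Op.odot, x => unitOdot (x 0) (x 1)
    | Op.oplus, x => unitOplus (x 0) (x 1)
  RelMap {_} r _ := r.elim

/-- The `(n+1)`-element positive MV-chain `{0, 1/n, …, (n-1)/n, 1}`, for `n ≥ 1`, as a subalgebra
of the negation-free reduct of the standard MV-algebra on `[0, 1]`. -/
def chain (n : ℕ) [NeZero n] : sig.Substructure unitInterval where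
  carrier := {x | ∃ k : ℕ, k ≤ n ∧ (x : ℝ) = (k : ℝ) / n}
  fun_mem {_} f := by
    have hn : (0 : ℝ) < n := Nat.cast_pos.2 (Nat.pos_of_ne_zero (NeZero.ne n))
    intro x hx
    cases f with
    | zero => exact ⟨0, Nat.zero_le _, by simp [Language.Structure.funMap]⟩
    | one => exact ⟨n, le_rfl, by simp [Language.Structure.funMap, hn.ne']⟩
    | inf =>
      rcases min_choice (x 0) (x 1) with h | h
      · simpa only [Language.Structure.funMap, h] using hx 0
      · simpa only [Language.Structure.funMap, h] using hx 1
    | sup =>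
      rcases max_choice (x 0) (x 1) with h | h
      · simpa only [Language.Structure.funMap, h] using hx 0
      · simpa only [Language.Structure.funMap, h] using hx 1
    | odot =>
      obtain ⟨i, hi, hi'⟩ := hx 0
      obtain ⟨j, hj, hj'⟩ := hx 1
      refine ⟨i + j - n, by omega, ?_⟩
      change max 0 ((x 0 : ℝ) + x 1 - 1) = _
      rw [hi', hj']
      have e : (i : ℝ) / n + j / n - 1 = ((i : ℝ) + j - n) / n := by field_simp
      rw [e]
      rcases le_total n (i + j) with h | h
      · have h' : (n : ℝ) ≤ i + j := by exact_mod_cast h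
        rw [max_eq_right (div_nonneg (by linarith) hn.le), Nat.cast_sub h, Nat.cast_add]
      · have h' : (i : ℝ) + j ≤ n := by exact_mod_cast h
        rw [max_eq_left (div_nonpos_of_nonpos_of_nonneg (by linarith) hn.le),
          Nat.sub_eq_zero_of_le h]
        simp
    | oplus =>
      obtain ⟨i, hi, hi'⟩ := hx 0
      obtain ⟨j, hj, hj'⟩ := hx 1
      refine ⟨min n (i + j), min_le_left _ _, ?_⟩
      change min 1 ((x 0 : ℝ) + x 1) = _
      rw [hi', hj', ← add_div]
      rcases le_total n (i + j) with h | h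
      · have h' : (n : ℝ) ≤ i + j := by exact_mod_cast h
        rw [min_eq_left ((one_le_div hn).2 h'), min_eq_left h, div_self hn.ne']
      · have h' : (i : ℝ) + j ≤ n := by exact_mod_cast h
        rw [min_eq_right ((div_le_one hn).2 h'), min_eq_right h, Nat.cast_add]

/-- The carrier of the `(n+1)`-element positive MV-chain; it carries the algebra structure, the
linear order and the (discrete) topology inherited from `[0, 1]`. -/
abbrev PL (n : ℕ) [NeZero n] : Type := ↥(chain n)

instance (n : ℕ) [NeZero n] : Finite (PL n) := by
  have h : Set.Finite {x : unitInterval | ∃ k : ℕ, k ≤ n ∧ (x : ℝ) = (k : ℝ) / n} := by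
    refine Set.Finite.of_injOn (f := fun x : unitInterval => (x : ℝ))
      (t := (fun k : ℕ => (k : ℝ) / n) '' Set.Iic n) ?_ Subtype.val_injective.injOn
      ((Set.finite_Iic n).image _)
    rintro x ⟨k, hk, hx⟩
    exact ⟨k, hk, hx.symm⟩
  exact h.to_subtype

theorem PL_discreteTopology (n : ℕ) [NeZero n] : DiscreteTopology (PL n) := inferInstance

/-! ### The variety generated by a positive MV-chain -/

/-- `A` belongs to the variety generated by the `(n+1)`-element positive MV-chain: every identity
`s ≈ t` valid in the chain is valid in `A`. -/
class IsPMV (n : ℕ) [NeZero n] (A : Type u) [sig.Structure A] : Prop where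
  identity : ∀ s t : sig.Term ℕ,
    (∀ x : ℕ → PL n, s.realize x = t.realize x) → ∀ x : ℕ → A, s.realize x = t.realize x

/-! ### The distributive skeleton -/

section identities

/-- Application of a binary operation symbol to terms. -/
def app (f : Op 2) (s t : sig.Term ℕ) : sig.Term ℕ := Language.Functions.apply₂ (L := sig) f s t

/-- A constant symbol as a term. -/
def cst (f : Op 0) : sig.Term ℕ := Language.Constants.term (L := sig) f

/-- The assignment `0 ↦ a`, `1 ↦ b`, `k ↦ c` for `k ≥ 2`. -/
def assign {A : Type u} (a b c : A) : ℕ → A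
  | 0 => a
  | 1 => b
  | _ => c

section realize

variable {A : Type u} [sig.Structure A] (s t : sig.Term ℕ) (x : ℕ → A)

theorem realize_inf : (app Op.inf s t).realize x = inf (s.realize x) (t.realize x) :=
  Language.Term.realize_functions_apply₂

theorem realize_sup : (app Op.sup s t).realize x = sup (s.realize x) (t.realize x) :=
  Language.Term.realize_functions_apply₂

theorem realize_oplus : (app Op.oplus s t).realize x = oplus (s.realize x) (t.realize x) :=
  Language.Term.realize_functions_apply₂

theorem realize_zero : (cst Op.zero).realize x = zero A :=
  congrArg (Language.Structure.funMap (L := sig) (M := A) (n := 0) Op.zero)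
    (Subsingleton.elim _ _)

theorem realize_one : (cst Op.one).realize x = one A :=
  congrArg (Language.Structure.funMap (L := sig) (M := A) (n := 0) Op.one)
    (Subsingleton.elim _ _)

end realize

section chain

variable {n : ℕ} [NeZero n]

theorem PL_zero_le (a : PL n) : zero (PL n) ≤ a := a.1.2.1

theorem PL_le_one (a : PL n) : a ≤ one (PL n) := a.1.2.2

theorem PL_inf (a b : PL n) : inf a b = min a b := by
  rcases le_total a b with h | h
  · rw [min_eq_left h]; exact Subtype.ext (min_eq_left (α := unitInterval) h)
  · rw [min_eq_right h]; exact Subtype.ext (min_eq_right (α := unitInterval) h)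

theorem PL_sup (a b : PL n) : sup a b = max a b := by
  rcases le_total a b with h | h
  · rw [max_eq_right h]; exact Subtype.ext (max_eq_right (α := unitInterval) h)
  · rw [max_eq_left h]; exact Subtype.ext (max_eq_left (α := unitInterval) h)

theorem PL_oplus_mono {a b c d : PL n} (h : a ≤ b) (h' : c ≤ d) : oplus a c ≤ oplus b d := by
  change min 1 ((a.1 : ℝ) + c.1) ≤ min 1 ((b.1 : ℝ) + d.1)
  have h1 : (a.1 : ℝ) ≤ b.1 := h
  have h2 : (c.1 : ℝ) ≤ d.1 := h'
  exact min_le_min le_rfl (add_le_add h1 h2)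

theorem PL_odot_mono {a b c d : PL n} (h : a ≤ b) (h' : c ≤ d) : odot a c ≤ odot b d := by
  change max 0 ((a.1 : ℝ) + c.1 - 1) ≤ max 0 ((b.1 : ℝ) + d.1 - 1)
  have h1 : (a.1 : ℝ) ≤ b.1 := h
  have h2 : (c.1 : ℝ) ≤ d.1 := h'
  exact max_le_max le_rfl (by linarith)

theorem PL_oplus_inf (a b : PL n) :
    oplus (inf a b) (inf a b) = inf (oplus a a) (oplus b b) := by
  rcases le_total a b with h | h
  · rw [PL_inf, PL_inf, min_eq_left h, min_eq_left (PL_oplus_mono h h)]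
  · rw [PL_inf, PL_inf, min_eq_right h, min_eq_right (PL_oplus_mono h h)]

theorem PL_oplus_sup (a b : PL n) :
    oplus (sup a b) (sup a b) = sup (oplus a a) (oplus b b) := by
  rcases le_total a b with h | h
  · rw [PL_sup, PL_sup, max_eq_right h, max_eq_right (PL_oplus_mono h h)]
  · rw [PL_sup, PL_sup, max_eq_left h, max_eq_left (PL_oplus_mono h h)]

theorem PL_oplus_zero (n : ℕ) [NeZero n] : oplus (zero (PL n)) (zero (PL n)) = zero (PL n) := by
  refine Subtype.ext (Subtype.ext ?_)
  change min 1 ((0 : ℝ) + 0) = 0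
  simp

theorem PL_oplus_one (n : ℕ) [NeZero n] : oplus (one (PL n)) (one (PL n)) = one (PL n) := by
  refine Subtype.ext (Subtype.ext ?_)
  change min 1 ((1 : ℝ) + 1) = 1
  norm_num

end chain

section laws

variable {A : Type u} [sig.Structure A]

theorem inf_comm' (n : ℕ) [NeZero n] [IsPMV n A] (a b : A) : inf a b = inf b a := by
  simpa only [realize_inf, Language.Term.realize_var, assign] using
    IsPMV.identity (n := n) (app Op.inf (.var 0) (.var 1)) (app Op.inf (.var 1) (.var 0))
      (fun x => by
        simp only [realize_inf, Language.Term.realize_var, PL_inf]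
        exact _root_.inf_comm _ _) (assign a b b)

theorem sup_comm' (n : ℕ) [NeZero n] [IsPMV n A] (a b : A) : sup a b = sup b a := by
  simpa only [realize_sup, Language.Term.realize_var, assign] using
    IsPMV.identity (n := n) (app Op.sup (.var 0) (.var 1)) (app Op.sup (.var 1) (.var 0))
      (fun x => by
        simp only [realize_sup, Language.Term.realize_var, PL_sup]
        exact _root_.sup_comm _ _) (assign a b b)

theorem inf_assoc' (n : ℕ) [NeZero n] [IsPMV n A] (a b c : A) : inf (inf a b) c = inf a (inf b c) := by
  simpa only [realize_inf, Language.Term.realize_var, assign] using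
    IsPMV.identity (n := n) (app Op.inf (app Op.inf (.var 0) (.var 1)) (.var 2))
      (app Op.inf (.var 0) (app Op.inf (.var 1) (.var 2)))
      (fun x => by
        simp only [realize_inf, Language.Term.realize_var, PL_inf]
        exact _root_.inf_assoc _ _ _) (assign a b c)

theorem sup_assoc' (n : ℕ) [NeZero n] [IsPMV n A] (a b c : A) : sup (sup a b) c = sup a (sup b c) := by
  simpa only [realize_sup, Language.Term.realize_var, assign] using
    IsPMV.identity (n := n) (app Op.sup (app Op.sup (.var 0) (.var 1)) (.var 2))
      (app Op.sup (.var 0) (app Op.sup (.var 1) (.var 2)))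
      (fun x => by
        simp only [realize_sup, Language.Term.realize_var, PL_sup]
        exact _root_.sup_assoc _ _ _) (assign a b c)

theorem sup_inf_self' (n : ℕ) [NeZero n] [IsPMV n A] (a b : A) : sup a (inf a b) = a := by
  simpa only [realize_sup, realize_inf, Language.Term.realize_var, assign] using
    IsPMV.identity (n := n) (app Op.sup (.var 0) (app Op.inf (.var 0) (.var 1))) (.var 0)
      (fun x => by
        simp only [realize_sup, realize_inf, Language.Term.realize_var, PL_sup, PL_inf]
        exact _root_.sup_inf_self) (assign a b b)

theorem inf_sup_self' (n : ℕ) [NeZero n] [IsPMV n A] (a b : A) : inf a (sup a b) = a := by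
  simpa only [realize_sup, realize_inf, Language.Term.realize_var, assign] using
    IsPMV.identity (n := n) (app Op.inf (.var 0) (app Op.sup (.var 0) (.var 1))) (.var 0)
      (fun x => by
        simp only [realize_sup, realize_inf, Language.Term.realize_var, PL_sup, PL_inf]
        exact _root_.inf_sup_self) (assign a b b)

theorem inf_sup_left' (n : ℕ) [NeZero n] [IsPMV n A] (a b c : A) :
    inf a (sup b c) = sup (inf a b) (inf a c) := by
  simpa only [realize_sup, realize_inf, Language.Term.realize_var, assign] using
    IsPMV.identity (n := n) (app Op.inf (.var 0) (app Op.sup (.var 1) (.var 2)))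
      (app Op.sup (app Op.inf (.var 0) (.var 1)) (app Op.inf (.var 0) (.var 2)))
      (fun x => by
        simp only [realize_sup, realize_inf, Language.Term.realize_var, PL_sup, PL_inf]
        exact _root_.inf_sup_left _ _ _) (assign a b c)

theorem zero_sup' (n : ℕ) [NeZero n] [IsPMV n A] (a : A) : sup (zero A) a = a := by
  simpa only [realize_sup, realize_zero, Language.Term.realize_var, assign] using
    IsPMV.identity (n := n) (app Op.sup (cst Op.zero) (.var 0)) (.var 0)
      (fun x => by
        simp only [realize_sup, realize_zero, Language.Term.realize_var, PL_sup]
        exact max_eq_right (PL_zero_le _)) (assign a a a)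

theorem sup_one' (n : ℕ) [NeZero n] [IsPMV n A] (a : A) : sup a (one A) = one A := by
  simpa only [realize_sup, realize_one, Language.Term.realize_var, assign] using
    IsPMV.identity (n := n) (app Op.sup (.var 0) (cst Op.one)) (cst Op.one)
      (fun x => by
        simp only [realize_sup, realize_one, Language.Term.realize_var, PL_sup]
        exact max_eq_right (PL_le_one _)) (assign a a a)

theorem oplus_inf' (n : ℕ) [NeZero n] [IsPMV n A] (a b : A) :
    oplus (inf a b) (inf a b) = inf (oplus a a) (oplus b b) := by
  simpa only [realize_oplus, realize_inf, Language.Term.realize_var, assign] using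
    IsPMV.identity (n := n)
      (app Op.oplus (app Op.inf (.var 0) (.var 1)) (app Op.inf (.var 0) (.var 1)))
      (app Op.inf (app Op.oplus (.var 0) (.var 0)) (app Op.oplus (.var 1) (.var 1)))
      (fun x => by
        simp only [realize_oplus, realize_inf, Language.Term.realize_var]
        exact PL_oplus_inf _ _) (assign a b b)

theorem oplus_sup' (n : ℕ) [NeZero n] [IsPMV n A] (a b : A) :
    oplus (sup a b) (sup a b) = sup (oplus a a) (oplus b b) := by
  simpa only [realize_oplus, realize_sup, Language.Term.realize_var, assign] using
    IsPMV.identity (n := n)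
      (app Op.oplus (app Op.sup (.var 0) (.var 1)) (app Op.sup (.var 0) (.var 1)))
      (app Op.sup (app Op.oplus (.var 0) (.var 0)) (app Op.oplus (.var 1) (.var 1)))
      (fun x => by
        simp only [realize_oplus, realize_sup, Language.Term.realize_var]
        exact PL_oplus_sup _ _) (assign a b b)

theorem oplus_zero' (n : ℕ) [NeZero n] (A : Type u) [sig.Structure A] [IsPMV n A] :
    oplus (zero A) (zero A) = zero A := by
  simpa only [realize_oplus, realize_zero] using
    IsPMV.identity (n := n) (app Op.oplus (cst Op.zero) (cst Op.zero)) (cst Op.zero)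
      (fun x => by
        simp only [realize_oplus, realize_zero]
        exact PL_oplus_zero n) (fun _ => zero A)

theorem oplus_one' (n : ℕ) [NeZero n] (A : Type u) [sig.Structure A] [IsPMV n A] :
    oplus (one A) (one A) = one A := by
  simpa only [realize_oplus, realize_one] using
    IsPMV.identity (n := n) (app Op.oplus (cst Op.one) (cst Op.one)) (cst Op.one)
      (fun x => by
        simp only [realize_oplus, realize_one]
        exact PL_oplus_one n) (fun _ => one A)

end laws

end identities

/-- The carrier `{a ∈ A | a ⊕ a = a}` of the distributive skeleton. The index `n` only records
the variety to which `A` belongs. -/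
def Skeleton (_n : ℕ) (A : Type u) [sig.Structure A] : Type u := {a : A // oplus a a = a}

namespace Skeleton

variable (n : ℕ) [NeZero n] (A : Type u) [sig.Structure A] [IsPMV n A]

/-- `∧` and `∨` of the skeleton are inherited from `A`; the order is the one they determine. -/
instance : Lattice (Skeleton n A) :=
  letI : Min (Skeleton n A) :=
    ⟨fun a b => ⟨inf a.1 b.1, by rw [oplus_inf' n, a.2, b.2]⟩⟩
  letI : Max (Skeleton n A) :=
    ⟨fun a b => ⟨sup a.1 b.1, by rw [oplus_sup' n, a.2, b.2]⟩⟩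
  Lattice.mk'
    (fun a b => Subtype.ext (sup_comm' n a.1 b.1))
    (fun a b c => Subtype.ext (sup_assoc' n a.1 b.1 c.1))
    (fun a b => Subtype.ext (inf_comm' n a.1 b.1))
    (fun a b c => Subtype.ext (inf_assoc' n a.1 b.1 c.1))
    (fun a b => Subtype.ext (sup_inf_self' n a.1 b.1))
    (fun a b => Subtype.ext (inf_sup_self' n a.1 b.1))

instance : DistribLattice (Skeleton n A) :=
  DistribLattice.ofInfSupLe fun a b c =>
    le_of_eq (Subtype.ext (inf_sup_left' n a.1 b.1 c.1))

/-- The bounds of the skeleton are the constants `0` and `1` of `A`. -/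
instance : BoundedOrder (Skeleton n A) where
  bot := ⟨zero A, oplus_zero' n A⟩
  top := ⟨one A, oplus_one' n A⟩
  bot_le a := sup_eq_right.1 (Subtype.ext (zero_sup' n a.1))
  le_top a := sup_eq_right.1 (Subtype.ext (sup_one' n a.1))

end Skeleton

/-! ### Priestley duals and Priestley powers -/

/-- The underlying set of the Priestley dual of a bounded distributive lattice `D`: the bounded
lattice homomorphisms from `D` to the two-element lattice. -/
def PriestleyDual (D : Type u) [DistribLattice D] [BoundedOrder D] : Type u :=
  BoundedLatticeHom D Bool

namespace PriestleyDual

variable (D : Type u) [DistribLattice D] [BoundedOrder D]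

noncomputable instance : FunLike (PriestleyDual D) D Bool :=
  (inferInstance : FunLike (BoundedLatticeHom D Bool) D Bool)

/-- The dual is ordered pointwise. -/
noncomputable instance : PartialOrder (PriestleyDual D) :=
  PartialOrder.lift (fun p : PriestleyDual D => (p : D → Bool)) DFunLike.coe_injective

/-- The dual carries the topology of a subspace of the power `2 ^ D` of the discrete space `2`. -/
noncomputable instance : TopologicalSpace (PriestleyDual D) :=
  TopologicalSpace.induced (fun p : PriestleyDual D => (p : D → Bool)) inferInstance

end PriestleyDual

/-- The Priestley power `M[D]`: the continuous order-preserving maps from the Priestley dual of `D`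
to the ordered discrete space `M`. -/
noncomputable def PriestleyPower (M : Type v) [PartialOrder M] [TopologicalSpace M]
    (D : Type u) [DistribLattice D] [BoundedOrder D] : Type (max u v) :=
  PriestleyDual D →Co M

/-- All operations of the ordered algebra `M` are order-preserving. -/
class MonotoneOperations (M : Type v) [PartialOrder M] [sig.Structure M] : Prop where
  monotone_funMap : ∀ {k : ℕ} (f : sig.Functions k),
    Monotone fun x : Fin k → M => Language.Structure.funMap f x

/-- The operations of a Priestley power are computed pointwise. -/
noncomputable instance priestleyPowerStructure (M : Type v) [PartialOrder M] [TopologicalSpace M]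
    [DiscreteTopology M] [sig.Structure M] [MonotoneOperations M]
    (D : Type u) [DistribLattice D] [BoundedOrder D] : sig.Structure (PriestleyPower M D) where
  funMap {k} f α :=
    let β : Fin k → (PriestleyDual D →Co M) := α
    { toFun := fun p => Language.Structure.funMap f fun i => β i p
      monotone' := fun _ _ h =>
        MonotoneOperations.monotone_funMap f fun i => (β i).monotone' h
      continuous_toFun :=
        (continuous_of_discreteTopology
          (f := fun x : Fin k → M => Language.Structure.funMap f x)).comp
          (continuous_pi fun i => (β i).continuous_toFun) }
  RelMap {_} r _ := r.elim

instance (n : ℕ) [NeZero n] : MonotoneOperations (PL n) where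
  monotone_funMap {_} f x y h := by
    cases f with
    | zero => exact le_rfl
    | one => exact le_rfl
    | inf => exact min_le_min (α := unitInterval) (h 0) (h 1)
    | sup => exact max_le_max (α := unitInterval) (h 0) (h 1)
    | odot => exact PL_odot_mono (h 0) (h 1)
    | oplus => exact PL_oplus_mono (h 0) (h 1)

end PosMV

/-! Write `τ_i` for a unary term that is `1` on chain elements `≥ i / n` and `0` below them.
Doubling through `⊕` and `⊙` produces such terms (`exists_threshold`). Their values are idempotent
in the chain, hence in every `A` of the variety, so each `a` yields a decreasing sequence `cut n i
a` in the skeleton, from `⊤` at `i = 0` to `⊥` beyond `n`. A point `p` of the dual turns this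
sequence into a single element of the chain, the largest `i / n` with `p (cut n i a) = true`; this
is `evalAt a p`.

Everything else is an identity or inequality checked in the chain and transferred to `A`. The
operations are preserved because they are monotone: `cut_inf_cut_le` and `cut_le_cut_sup_cut` bound
each cut of `f(a, b)` from below and above by cuts of `a` and `b`. Injectivity combines two facts:
the cuts determine `a` (`le_of_cut_le`), and prime ideals separate elements of the skeleton
(`PriestleyDual.exists_separating`). No subdirect decomposition of `A` is needed. -/

namespace PosMV

open Language

/-! ### Threshold terms -/

/-- Truncation to the unit interval turns doubling into `⊕` and `⊙`: the map
`x ↦ max 0 (min 1 (2 ^ k * x - a))` is a term function. -/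
theorem exists_term_stretch (k a : ℕ) : ∃ t : sig.Term Unit, ∀ x : unitInterval,
    ((t.realize fun _ => x : unitInterval) : ℝ) = max 0 (min 1 (2 ^ k * (x : ℝ) - a)) := by
  induction k generalizing a with
  | zero =>
    rcases Nat.eq_zero_or_pos a with rfl | ha
    · refine ⟨.var (), fun x => ?_⟩
      have h0 := x.2.1
      have h1 := x.2.2
      simp [h0, h1]
    · refine ⟨Constants.term (L := sig) Op.zero, fun x => ?_⟩
      have h1 := x.2.2
      have ha' : (1 : ℝ) ≤ a := by exact_mod_cast ha
      have : (2 : ℝ) ^ 0 * (x : ℝ) - a ≤ 0 := by linarith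
      rw [max_eq_left ((min_le_right _ _).trans this)]
      rfl
  | succ k ih =>
    -- With `y = 2 ^ k * x - b` already clamped to `[0, 1]`, `⊕` with itself gives the clamp of `2 *
    -- y` and `⊙` with itself that of `2 * y - 1`. The parity of `a` selects the operation, so `a`
    -- is consumed as binary digits.
    obtain ⟨b, rfl | rfl⟩ := Nat.even_or_odd' a
    · obtain ⟨t, ht⟩ := ih b
      refine ⟨Functions.apply₂ (L := sig) Op.oplus t t, fun x => ?_⟩
      refine (congrArg Subtype.val (Term.realize_functions_apply₂ (L := sig) (M := unitInterval)
        (f := Op.oplus) (t₁ := t) (t₂ := t) (v := fun _ => x))).trans ?_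
      change min 1 (((t.realize fun _ => x : unitInterval) : ℝ) + _) = _
      have e : (2 : ℝ) ^ (k + 1) * (x : ℝ) - (2 * b : ℕ) = 2 * (2 ^ k * (x : ℝ) - b) := by
        push_cast; ring
      simp only [Matrix.cons_val_one, Matrix.cons_val_zero]
      rw [ht, e]
      grind
    · obtain ⟨t, ht⟩ := ih b
      refine ⟨Functions.apply₂ (L := sig) Op.odot t t, fun x => ?_⟩
      refine (congrArg Subtype.val (Term.realize_functions_apply₂ (L := sig) (M := unitInterval)
        (f := Op.odot) (t₁ := t) (t₂ := t) (v := fun _ => x))).trans ?_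
      change max 0 (((t.realize fun _ => x : unitInterval) : ℝ) + _ - 1) = _
      have e : (2 : ℝ) ^ (k + 1) * (x : ℝ) - (2 * b + 1 : ℕ) = 2 * (2 ^ k * (x : ℝ) - b) - 1 := by
        push_cast; ring
      simp only [Matrix.cons_val_one, Matrix.cons_val_zero]
      rw [ht, e]
      grind

section level

variable {n : ℕ} [NeZero n]

/-- The numerator `k` of an element `k / n` of the chain. -/
noncomputable def level (x : PL n) : ℕ := x.2.choose

theorem level_le (x : PL n) : level x ≤ n := x.2.choose_spec.1

theorem coe_eq_level_div (x : PL n) : (x.1 : ℝ) = level x / n := x.2.choose_spec.2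

theorem natCast_pos_of_neZero (n : ℕ) [NeZero n] : (0 : ℝ) < n :=
  Nat.cast_pos.2 (Nat.pos_of_ne_zero (NeZero.ne n))

theorem level_le_level {x y : PL n} : level x ≤ level y ↔ x ≤ y := by
  change _ ↔ (x.1 : ℝ) ≤ y.1
  rw [coe_eq_level_div, coe_eq_level_div, div_le_div_iff_of_pos_right (natCast_pos_of_neZero n),
    Nat.cast_le]

theorem level_injective : Function.Injective (level (n := n)) := fun _ _ h =>
  le_antisymm (level_le_level.1 h.le) (level_le_level.1 h.ge)

/-- The element `k / n` of the chain. -/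
noncomputable def ofLevel (k : ℕ) (hk : k ≤ n) : PL n :=
  ⟨⟨(k : ℝ) / n, by positivity,
    (div_le_one (natCast_pos_of_neZero n)).2 (by exact_mod_cast hk)⟩, k, hk, rfl⟩

theorem level_ofLevel (k : ℕ) (hk : k ≤ n) : level (ofLevel k hk) = k := by
  have h := coe_eq_level_div (ofLevel k hk)
  change (k : ℝ) / n = _ at h
  rw [div_left_inj' (natCast_pos_of_neZero n).ne'] at h
  exact_mod_cast h.symm

theorem PL_realize_coe {α : Type*} (t : sig.Term α) (x : α → PL n) :
    ((t.realize x : PL n) : unitInterval) = t.realize fun i => (x i : unitInterval) :=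
  (HomClass.realize_term (chain n).subtype).symm

-- A steep enough stretch, placed between two neighbouring elements of the chain, takes only the
-- values `0` and `1` on the chain.
open Classical in
theorem exists_threshold (n : ℕ) [NeZero n] (i : ℕ) : ∃ t : sig.Term Unit, ∀ x : PL n,
    t.realize (fun _ => x) = if i ≤ level x then one (PL n) else zero (PL n) := by
  rcases i with _ | i
  · exact ⟨Constants.term (L := sig) Op.one, fun x => by
      rw [if_pos (Nat.zero_le _)]
      exact congrArg (Structure.funMap (L := sig) (M := PL n) (n := 0) Op.one)
        (Subsingleton.elim _ _)⟩
  have hn := natCast_pos_of_neZero n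
  -- The gap from `i / n` to `(i + 1) / n` is stretched to length above `2`. Rounding the offset up
  -- to an integer costs less than `1`, so at least `1` remains at `(i + 1) / n`, while everything
  -- up to `i / n` lands at or below `0`.
  obtain ⟨k, hk⟩ := pow_unbounded_of_one_lt (2 * n : ℝ) one_lt_two
  obtain ⟨t, ht⟩ := exists_term_stretch k ⌈(2 : ℝ) ^ k * (i / n)⌉₊
  have h1 := Nat.le_ceil ((2 : ℝ) ^ k * (i / n))
  have h2 := Nat.ceil_lt_add_one (a := (2 : ℝ) ^ k * (i / n)) (by positivity)
  refine ⟨t, fun x => Subtype.ext (Subtype.ext ?_)⟩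
  rw [PL_realize_coe, ht, coe_eq_level_div]
  split_ifs with h
  · change _ = (1 : ℝ)
    have h3 : ((i : ℝ) + 1) / n ≤ level x / n := by gcongr; exact_mod_cast h
    have h4 := mul_le_mul_of_nonneg_left h3 (by positivity : (0 : ℝ) ≤ 2 ^ k)
    have h5 : (2 : ℝ) ≤ 2 ^ k / n := by rw [le_div_iff₀ hn]; exact hk.le
    have h6 : (2 : ℝ) ^ k * (((i : ℝ) + 1) / n) = 2 ^ k * (i / n) + 2 ^ k / n := by ring
    rw [min_eq_left (by linarith), max_eq_right zero_le_one]
  · change _ = (0 : ℝ)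
    have h3 : (level x : ℝ) / n ≤ i / n := by gcongr; omega
    have h4 := mul_le_mul_of_nonneg_left h3 (by positivity : (0 : ℝ) ≤ 2 ^ k)
    exact max_eq_left ((min_le_right _ _).trans (by linarith))

/-- A unary term whose value in the chain is `1` at the elements `≥ i / n` and `0` elsewhere. -/
noncomputable def threshold (n : ℕ) [NeZero n] (i : ℕ) : sig.Term Unit :=
  (exists_threshold n i).choose

/-- The threshold term applied to a term. -/
noncomputable def thr (n : ℕ) [NeZero n] (i : ℕ) (s : sig.Term ℕ) : sig.Term ℕ :=
  (threshold n i).subst fun _ => s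

open Classical in
theorem PL_realize_threshold (i : ℕ) (x : PL n) :
    (threshold n i).realize (fun _ => x) = if i ≤ level x then one (PL n) else zero (PL n) :=
  (exists_threshold n i).choose_spec x

theorem realize_thr {A : Type u} [sig.Structure A] (i : ℕ) (s : sig.Term ℕ) (x : ℕ → A) :
    (thr n i s).realize x = (threshold n i).realize fun _ => s.realize x :=
  Term.realize_subst

theorem realize_app {A : Type u} [sig.Structure A] (f : Op 2) (s t : sig.Term ℕ) (x : ℕ → A) :
    (app f s t).realize x =
      Structure.funMap (L := sig) (n := 2) f ![s.realize x, t.realize x] :=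
  Term.realize_functions_apply₂

end level

/-! ### Transfer of inequalities from the chain -/

section transfer

variable {n : ℕ} [NeZero n] {A : Type u} [sig.Structure A] [IsPMV n A]

/-- An inequality `s ≤ t` is the identity `s ∨ t ≈ t`, so it passes from the chain to the whole
variety. -/
theorem sup_realize_eq (s t : sig.Term ℕ)
    (h : ∀ x : ℕ → PL n, s.realize x ≤ t.realize x) (x : ℕ → A) :
    sup (s.realize x) (t.realize x) = t.realize x := by
  rw [← realize_sup]
  refine IsPMV.identity (n := n) _ _ (fun y => ?_) x
  rw [realize_sup, PL_sup, max_eq_right (h y)]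

/-- The lattice reduct of an algebra in the variety. -/
abbrev distribLattice (n : ℕ) [NeZero n] (A : Type u) [sig.Structure A] [IsPMV n A] :
    DistribLattice A :=
  letI : Min A := ⟨inf⟩
  letI : Max A := ⟨sup⟩
  letI : Lattice A := Lattice.mk' (sup_comm' n) (sup_assoc' n) (inf_comm' n) (inf_assoc' n)
    (sup_inf_self' n) (inf_sup_self' n)
  DistribLattice.ofInfSupLe fun a b c => le_of_eq (inf_sup_left' n a b c)

/-- The threshold `i / n` of an element, as an element of the skeleton. -/
noncomputable def cut (n : ℕ) [NeZero n] {A : Type u} [sig.Structure A] [IsPMV n A]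
    (i : ℕ) (a : A) : Skeleton n A :=
  ⟨(threshold n i).realize fun _ => a, by
    have h := IsPMV.identity (n := n) (app Op.oplus (thr n i (.var 0)) (thr n i (.var 0)))
      (thr n i (.var 0)) (fun x => by
        rw [realize_oplus, realize_thr, PL_realize_threshold]
        split_ifs
        · exact PL_oplus_one n
        · exact PL_oplus_zero n) fun _ => a
    rwa [realize_oplus, realize_thr] at h⟩

theorem Skeleton.le_iff {a b : Skeleton n A} : a ≤ b ↔ sup a.1 b.1 = b.1 :=
  sup_eq_right.symm.trans Subtype.ext_iff

theorem cut_zero (a : A) : cut n 0 a = ⊤ := by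
  refine Subtype.ext ?_
  have h := IsPMV.identity (n := n) (thr n 0 (.var 0)) (cst Op.one) (fun x => by
    rw [realize_thr, PL_realize_threshold, realize_one, if_pos (Nat.zero_le _)]) fun _ => a
  rwa [realize_thr, realize_one] at h

theorem cut_eq_bot {i : ℕ} (hi : n < i) (a : A) : cut n i a = ⊥ := by
  refine Subtype.ext ?_
  have h := IsPMV.identity (n := n) (thr n i (.var 0)) (cst Op.zero) (fun x => by
    rw [realize_thr, PL_realize_threshold, realize_zero,
      if_neg fun h => (h.trans (level_le _)).not_gt hi]) fun _ => a
  rwa [realize_thr, realize_zero] at h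

theorem PL_threshold_le_threshold {i j : ℕ} {x y : PL n} (h : i ≤ level x → j ≤ level y) :
    (threshold n i).realize (fun _ => x) ≤ (threshold n j).realize fun _ => y := by
  rw [PL_realize_threshold, PL_realize_threshold]
  split_ifs with h1 h2 h2
  · exact le_rfl
  · exact absurd (h h1) h2
  · exact PL_zero_le _
  · exact le_rfl

theorem cut_anti {i j : ℕ} (h : i ≤ j) (a : A) : cut n j a ≤ cut n i a := by
  have := sup_realize_eq (n := n) (thr n j (.var 0)) (thr n i (.var 0)) (fun x => by
    rw [realize_thr, realize_thr]
    exact PL_threshold_le_threshold h.trans) fun _ => a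
  rw [realize_thr, realize_thr] at this
  exact Skeleton.le_iff.2 this

/-- By monotonicity of `f`, `x ≥ u` and `y ≥ v` force `f(x, y) ≥ f(u, v)`. Since only monotonicity
enters, all four binary operations are covered at once. -/
theorem cut_inf_cut_le (f : Op 2) {i : ℕ} {u v : PL n}
    (h : i ≤ level (Structure.funMap (L := sig) (M := PL n) (n := 2) f ![u, v])) (a b : A) :
    cut n (level u) a ⊓ cut n (level v) b ≤
      cut n i (Structure.funMap (L := sig) (n := 2) f ![a, b]) := by
  have := sup_realize_eq (n := n)
    (app Op.inf (thr n (level u) (.var 0)) (thr n (level v) (.var 1)))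
    (thr n i (app f (.var 0) (.var 1))) (fun x => by
      rw [realize_inf, realize_thr, realize_thr, realize_thr, realize_app, PL_inf]
      by_cases hu : level u ≤ level (x 0)
      · by_cases hv : level v ≤ level (x 1)
        · refine (min_le_left _ _).trans (PL_threshold_le_threshold fun _ => h.trans ?_)
          refine level_le_level.2 (MonotoneOperations.monotone_funMap (M := PL n) (k := 2) f ?_)
          intro j
          fin_cases j
          · exact level_le_level.1 hu
          · exact level_le_level.1 hv
        · exact (min_le_right _ _).trans (PL_threshold_le_threshold fun h => absurd h hv)
      · exact (min_le_left _ _).trans (PL_threshold_le_threshold fun h => absurd h hu))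
    (assign a b b)
  rw [realize_inf, realize_thr, realize_thr, realize_thr, realize_app] at this
  exact Skeleton.le_iff.2 this

/-- The contrapositive companion: if `x ≤ u` and `y ≤ v`, then `f(x, y) ≤ f(u, v)` stays below level
`i`. Exceeding `u` means reaching the next level, whence the `+ 1`. -/
theorem cut_le_cut_sup_cut (f : Op 2) {i : ℕ} {u v : PL n}
    (h : level (Structure.funMap (L := sig) (M := PL n) (n := 2) f ![u, v]) < i) (a b : A) :
    cut n i (Structure.funMap (L := sig) (n := 2) f ![a, b]) ≤
      cut n (level u + 1) a ⊔ cut n (level v + 1) b := by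
  have := sup_realize_eq (n := n) (thr n i (app f (.var 0) (.var 1)))
    (app Op.sup (thr n (level u + 1) (.var 0)) (thr n (level v + 1) (.var 1))) (fun x => by
      rw [realize_sup, realize_thr, realize_thr, realize_thr, realize_app, PL_sup]
      by_cases hu : level u + 1 ≤ level (x 0)
      · exact (PL_threshold_le_threshold fun _ => hu).trans (le_max_left _ _)
      by_cases hv : level v + 1 ≤ level (x 1)
      · exact (PL_threshold_le_threshold fun _ => hv).trans (le_max_right _ _)
      refine (PL_threshold_le_threshold fun hi => absurd (hi.trans ?_) h.not_ge).trans
        (le_max_left _ _)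
      refine level_le_level.2 (MonotoneOperations.monotone_funMap (M := PL n) (k := 2) f ?_)
      intro j
      fin_cases j
      · exact level_le_level.1 (Nat.le_of_lt_succ (not_le.1 hu))
      · exact level_le_level.1 (Nat.le_of_lt_succ (not_le.1 hv)))
    (assign a b b)
  rw [realize_sup, realize_thr, realize_thr, realize_thr, realize_app] at this
  exact Skeleton.le_iff.2 this

theorem cut_constant (f : Op 0) (i : ℕ) :
    (i ≤ level (Structure.funMap (L := sig) (M := PL n) (n := 0) f ![]) ∧
      cut n i (Structure.funMap (L := sig) (M := A) (n := 0) f ![]) = ⊤) ∨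
    (¬ i ≤ level (Structure.funMap (L := sig) (M := PL n) (n := 0) f ![]) ∧
      cut n i (Structure.funMap (L := sig) (M := A) (n := 0) f ![]) = ⊥) := by
  have hc : ∀ (B : Type u) [sig.Structure B] (x : ℕ → B), (cst f).realize x =
      Structure.funMap (L := sig) (M := B) (n := 0) f ![] := fun B _ x =>
    congrArg (Structure.funMap (L := sig) (M := B) (n := 0) f) (Subsingleton.elim _ _)
  -- The chain lives in `Type` and `A` in `Type u`, so `hc` does not apply to it.
  have hc' : ∀ x : ℕ → PL n, (cst f).realize x =
      Structure.funMap (L := sig) (M := PL n) (n := 0) f ![] := fun x =>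
    congrArg (Structure.funMap (L := sig) (M := PL n) (n := 0) f) (Subsingleton.elim _ _)
  by_cases h : i ≤ level (Structure.funMap (L := sig) (M := PL n) (n := 0) f ![])
  · refine Or.inl ⟨h, Subtype.ext ?_⟩
    have := IsPMV.identity (n := n) (thr n i (cst f)) (cst Op.one) (fun x => by
      rw [realize_thr, PL_realize_threshold, realize_one, hc', if_pos h]) fun _ => zero A
    rwa [realize_thr, realize_one, hc] at this
  · refine Or.inr ⟨h, Subtype.ext ?_⟩
    have := IsPMV.identity (n := n) (thr n i (cst f)) (cst Op.zero) (fun x => by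
      rw [realize_thr, PL_realize_threshold, realize_zero, hc', if_neg h]) fun _ => zero A
    rwa [realize_thr, realize_zero, hc] at this

/-- The inequality that drives the induction in `le_of_cut_le`. In the chain it can only fail when
`b < a`; then either `b` has level at least `i`, so `a` reaches `i + 1` and the right side is `1`,
or the cut of `b` is `0`. -/
theorem inf_cut_le_sup_cut (i : ℕ) (a b : A) :
    letI := distribLattice n A
    a ⊓ (cut n i b).1 ≤ b ⊔ (cut n (i + 1) a).1 := by
  let := distribLattice n A
  have := sup_realize_eq (n := n) (app Op.inf (.var 0) (thr n i (.var 1)))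
    (app Op.sup (.var 1) (thr n (i + 1) (.var 0))) (fun x => by
      rw [realize_inf, realize_sup, realize_thr, realize_thr, PL_inf, PL_sup]
      simp only [Term.realize_var]
      rw [PL_realize_threshold, PL_realize_threshold]
      rcases le_or_gt (x 0) (x 1) with h | h
      · exact (min_le_left _ _).trans (h.trans (le_max_left _ _))
      have h' : level (x 1) < level (x 0) := not_le.1 fun hl => h.not_ge (level_le_level.1 hl)
      by_cases h1 : i ≤ level (x 1)
      · rw [if_pos (show i + 1 ≤ level (x 0) by omega)]
        exact (min_le_left _ _).trans ((PL_le_one _).trans (le_max_right _ _))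
      · rw [if_neg h1]
        exact (min_le_right _ _).trans ((PL_zero_le _).trans (le_max_left _ _)))
    (assign a b b)
  rw [realize_inf, realize_sup, realize_thr, realize_thr] at this
  exact sup_eq_right.1 this

/-- The order of an algebra in the variety is determined by the thresholds. -/
theorem le_of_cut_le {a b : A} (h : ∀ i, cut n i a ≤ cut n i b) :
    letI := distribLattice n A
    a ≤ b := by
  let := distribLattice n A
  have h' : ∀ i, (cut n i a).1 ≤ (cut n i b).1 := fun i =>
    sup_eq_right.1 (Skeleton.le_iff.1 (h i))
  -- Climbing from `i = 0`, where the cut is `1` and nothing is claimed, to `i = n + 1`, where the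
  -- cut is `0` and `a ≤ b` is left.
  have key : ∀ i, a ≤ b ⊔ (cut n i b).1 := by
    intro i
    induction i with
    | zero =>
      rw [cut_zero]
      exact le_sup_of_le_right (sup_eq_right.1 (sup_one' n a))
    | succ i ih =>
      calc a ≤ a ⊓ (b ⊔ (cut n i b).1) := le_inf le_rfl ih
        _ = a ⊓ b ⊔ a ⊓ (cut n i b).1 := inf_sup_left _ _ _
        _ ≤ b ⊔ (b ⊔ (cut n (i + 1) a).1) := sup_le_sup inf_le_right (inf_cut_le_sup_cut i a b)
        _ ≤ b ⊔ (cut n (i + 1) b).1 :=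
          sup_le le_sup_left (sup_le le_sup_left (le_sup_of_le_right (h' _)))
  have hk := key (n + 1)
  rw [cut_eq_bot n.lt_succ_self] at hk
  exact hk.trans (sup_le le_rfl (sup_eq_right.1 (zero_sup' n b)))

theorem eq_of_cut_eq {a b : A} (h : ∀ i, cut n i a = cut n i b) : a = b :=
  letI := distribLattice n A
  le_antisymm (le_of_cut_le fun i => (h i).le) (le_of_cut_le fun i => (h i).ge)

end transfer

/-! ### The dual separates points -/

/-- The prime ideal theorem gives a prime ideal containing `b` but not `a`; `p` is the indicator of
its complement. -/
theorem PriestleyDual.exists_separating {D : Type u} [DistribLattice D] [BoundedOrder D] {a b : D}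
    (h : ¬ a ≤ b) : ∃ p : PriestleyDual D, p a = true ∧ p b = false := by
  classical
  have hd : Disjoint (Order.PFilter.principal a : Set D) (Order.Ideal.principal b : Set D) :=
    Set.disjoint_left.2 fun c hc hc' => h (le_trans (Order.PFilter.mem_principal.1 hc)
      (Order.Ideal.mem_principal.1 hc'))
  obtain ⟨J, hJ, hb, ha⟩ := DistribLattice.prime_ideal_of_disjoint_filter_ideal hd
  have haJ : a ∉ J := fun hm => Set.disjoint_left.1 ha (Order.PFilter.mem_principal.2 le_rfl) hm
  have hbJ : b ∈ J := hb (Order.Ideal.mem_principal.2 le_rfl)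
  let p : BoundedLatticeHom D Bool :=
    { toFun := fun c => decide (c ∉ J)
      map_sup' := fun c d => by
        simp only [Order.Ideal.sup_mem_iff]
        by_cases hc : c ∈ J <;> by_cases hd : d ∈ J <;> simp [hc, hd]
      map_inf' := fun c d => by
        have : c ⊓ d ∈ J ↔ c ∈ J ∨ d ∈ J :=
          ⟨hJ.mem_or_mem, fun h => h.elim (J.lower inf_le_left) (J.lower inf_le_right)⟩
        simp only [this]
        by_cases hc : c ∈ J <;> by_cases hd : d ∈ J <;> simp [hc, hd]
      map_top' := by simpa using fun ht => haJ (J.lower le_top ht)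
      map_bot' := by simp }
  exact ⟨p, decide_eq_true haJ, decide_eq_false (not_not.2 hbJ)⟩

/-! ### The embedding into the Priestley power -/

section embedding

variable {n : ℕ} [NeZero n] {A : Type u} [sig.Structure A] [IsPMV n A]

/-- The value of `a` at a point of the dual of the skeleton. -/
noncomputable def evalAt (a : A) (p : PriestleyDual (Skeleton n A)) : PL n :=
  -- The default `0` of `Nat.findGreatest` is a genuine value, since `cut n 0 a = ⊤`; searching only
  -- up to `n` loses nothing, since later cuts are `⊥`.
  ofLevel (Nat.findGreatest (fun i => p (cut n i a) = true) n) (Nat.findGreatest_le n)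

theorem PriestleyDual.mono {D : Type u} [DistribLattice D] [BoundedOrder D] (p : PriestleyDual D)
    {a b : D} (h : a ≤ b) (ha : p a = true) : p b = true :=
  top_le_iff.1 (ha.ge.trans (OrderHomClass.mono (F := BoundedLatticeHom D Bool) p h))

/-- The working characterization of `evalAt`, valid for every `i`, including `i > n`. It makes
statements about values into statements about cuts. -/
theorem le_level_evalAt {a : A} {p : PriestleyDual (Skeleton n A)} {i : ℕ} :
    i ≤ level (evalAt a p) ↔ p (cut n i a) = true := by
  rw [evalAt, level_ofLevel]
  constructor
  · intro h
    have h0 : p (cut n 0 a) = true := by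
      rw [cut_zero]
      exact map_top (F := BoundedLatticeHom (Skeleton n A) Bool) p
    exact p.mono (cut_anti h a) (Nat.findGreatest_spec (P := fun i => p (cut n i a) = true)
      (Nat.zero_le n) h0)
  · intro h
    refine Nat.le_findGreatest (not_lt.1 fun hi => ?_) h
    rw [cut_eq_bot hi] at h
    exact Bool.false_ne_true
      ((map_bot (F := BoundedLatticeHom (Skeleton n A) Bool) p).symm.trans h)

theorem continuous_evalAt (a : A) : Continuous (evalAt (n := n) a) := by
  have hc : ∀ i, IsClopen {p : PriestleyDual (Skeleton n A) | p (cut n i a) = true} := fun i =>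
    (isClopen_discrete ({true} : Set Bool)).preimage
      ((continuous_apply (cut n i a)).comp continuous_induced_dom)
  refine continuous_discrete_rng.2 fun x => ?_
  -- The fibre over `x` consists of the points that accept the cut at `level x` and reject the next
  -- one.
  convert ((hc (level x)).inter (hc (level x + 1)).compl).isOpen using 1
  ext p
  simp only [Set.mem_preimage, Set.mem_singleton_iff, Set.mem_inter_iff, Set.mem_ofPred_eq,
    Set.mem_compl_iff, ← le_level_evalAt, ← level_injective.eq_iff]
  omega

theorem evalAt_mono (a : A) : Monotone (evalAt (n := n) a) := fun p _ h =>
  level_le_level.1 (le_level_evalAt.2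
    (top_le_iff.1 ((le_level_evalAt.1 le_rfl).ge.trans (h (cut n (level (evalAt a p)) a)))))

theorem evalAt_funMap₀ (f : Op 0) (p : PriestleyDual (Skeleton n A)) :
    evalAt (Structure.funMap (L := sig) (M := A) (n := 0) f ![]) p =
      Structure.funMap (L := sig) (M := PL n) (n := 0) f ![] := by
  refine level_injective (eq_of_forall_le_iff fun i => ?_)
  rw [le_level_evalAt]
  rcases cut_constant (n := n) (A := A) f i with ⟨h, e⟩ | ⟨h, e⟩
  · rw [e]
    exact iff_of_true (map_top (F := BoundedLatticeHom (Skeleton n A) Bool) p) h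
  · rw [e]
    exact iff_of_false (fun ht => Bool.false_ne_true
      ((map_bot (F := BoundedLatticeHom (Skeleton n A) Bool) p).symm.trans ht)) h

/-- Both cut inequalities are applied with `u = evalAt a p` and `v = evalAt b p`: `p` accepts the
cuts of `a` and `b` at these levels and rejects the next ones, which fixes the level of `f(a, b)`
from both sides. -/
theorem evalAt_funMap₂ (f : Op 2) (a b : A) (p : PriestleyDual (Skeleton n A)) :
    evalAt (Structure.funMap (L := sig) (n := 2) f ![a, b]) p =
      Structure.funMap (L := sig) (M := PL n) (n := 2) f ![evalAt a p, evalAt b p] := by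
  refine level_injective (eq_of_forall_le_iff fun i => ?_)
  rw [le_level_evalAt]
  have hlt : ∀ c : A, ¬ p (cut n (level (evalAt c p) + 1) c) = true := fun c hc =>
    (Nat.lt_succ_self _).not_ge (le_level_evalAt.2 hc)
  constructor
  · refine fun h => not_lt.1 fun hi => ?_
    have h' := p.mono (cut_le_cut_sup_cut f hi a b) h
    have h'' := (map_sup (F := BoundedLatticeHom (Skeleton n A) Bool) p _ _).symm.trans h'
    exact (Bool.or_eq_true_iff.1 h'').elim (hlt a) (hlt b)
  · intro h
    refine p.mono (cut_inf_cut_le f h a b) ?_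
    refine (map_inf (F := BoundedLatticeHom (Skeleton n A) Bool) p _ _).trans ?_
    exact Bool.and_eq_true_iff.2 ⟨le_level_evalAt.1 le_rfl, le_level_evalAt.1 le_rfl⟩

/-- The canonical map into the Priestley power of the skeleton. -/
noncomputable def toPower (n : ℕ) [NeZero n] {A : Type u} [sig.Structure A] [IsPMV n A] (a : A) :
    PriestleyPower (PL n) (Skeleton n A) :=
  ({ toFun := evalAt a
     monotone' := evalAt_mono a
     continuous_toFun := continuous_evalAt a } : PriestleyDual (Skeleton n A) →Co PL n)

theorem power_ext {α β : PriestleyPower (PL n) (Skeleton n A)}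
    (h : ∀ p, (show PriestleyDual (Skeleton n A) →Co PL n from α) p =
      (show PriestleyDual (Skeleton n A) →Co PL n from β) p) : α = β :=
  DFunLike.ext (F := PriestleyDual (Skeleton n A) →Co PL n) α β h

theorem toPower_injective : Function.Injective (toPower n (A := A)) := by
  intro a b h
  have he : ∀ p : PriestleyDual (Skeleton n A), evalAt a p = evalAt b p := fun p =>
    DFunLike.congr_fun (F := PriestleyDual (Skeleton n A) →Co PL n) h p
  have hle : ∀ {c d : A}, (∀ p : PriestleyDual (Skeleton n A), evalAt c p = evalAt d p) →
      ∀ i, cut n i c ≤ cut n i d := by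
    intro c d hcd i
    by_contra hn
    obtain ⟨p, hp, hp'⟩ := PriestleyDual.exists_separating hn
    rw [← le_level_evalAt, hcd, le_level_evalAt, hp'] at hp
    exact Bool.false_ne_true hp
  exact eq_of_cut_eq fun i => le_antisymm (hle he i) (hle (fun p => (he p).symm) i)

theorem toPower_funMap {k : ℕ} (f : sig.Functions k) (x : Fin k → A) :
    toPower n (Structure.funMap f x) = Structure.funMap f (toPower n ∘ x) := by
  refine power_ext fun p => ?_
  change evalAt (Structure.funMap f x) p = Structure.funMap f fun i => evalAt (x i) p
  have h0 (g : Op 0) (x : Fin 0 → A) : evalAt (Structure.funMap (L := sig) (n := 0) g x) p =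
      Structure.funMap (L := sig) (n := 0) g fun i => evalAt (x i) p := by
    rw [Subsingleton.elim x ![], evalAt_funMap₀]
    exact congrArg _ (Subsingleton.elim _ _)
  have h2 (g : Op 2) (x : Fin 2 → A) : evalAt (Structure.funMap (L := sig) (n := 2) g x) p =
      Structure.funMap (L := sig) (n := 2) g fun i => evalAt (x i) p := by
    have hx : x = ![x 0, x 1] := by ext i; fin_cases i <;> rfl
    rw [hx, evalAt_funMap₂]
    refine congrArg _ (funext fun i => ?_)
    fin_cases i <;> rfl
  cases f
  · exact h0 _ x
  · exact h0 _ x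
  all_goals exact h2 _ x

/-- The canonical embedding into the Priestley power of the skeleton. -/
noncomputable def powerEmbedding (n : ℕ) [NeZero n] (A : Type u) [sig.Structure A] [IsPMV n A] :
    A ↪[sig] PriestleyPower (PL n) (Skeleton n A) where
  toFun := toPower n
  inj' := toPower_injective
  map_fun' := toPower_funMap
  map_rel' r _ := r.elim

end embedding

end PosMV

/-- Every member `A` of the variety generated by the `(n+1)`-element positive MV-chain embeds into
the Priestley power of its distributive skeleton; in particular `A` is, up to isomorphism, a
subalgebra of a Priestley power of that chain. -/
theorem corollary4p7 (n : ℕ) [NeZero n] (A : Type u) [PosMV.sig.Structure A] [PosMV.IsPMV n A] :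
    Nonempty (A ↪[PosMV.sig] PosMV.PriestleyPower (PosMV.PL n) (PosMV.Skeleton n A)) ∧
    ∃ (D : Type u) (_ : DistribLattice D) (_ : BoundedOrder D)
      (S : PosMV.sig.Substructure (PosMV.PriestleyPower (PosMV.PL n) D)),
      Nonempty (A ≃[PosMV.sig] S) :=
  ⟨⟨PosMV.powerEmbedding n A⟩, PosMV.Skeleton n A, inferInstance, inferInstance,
    (PosMV.powerEmbedding n A).toHom.range, ⟨(PosMV.powerEmbedding n A).equivRange⟩⟩
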